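/- For $y\in\mathbb R$ let $\operatorname{sign}(y)\in\{-1,0,1\}$. A vector $x$ is $k$-sparse if its support $\operatorname{supp}(x)=\{j:x_j\neq0\}$ has at most $k$ elements. For $S\subseteq\mathbb R$ and a class $X$ of signals, an $m\times n$ real matrix $M$ \emph{can be used for $\varepsilon$-approximate recovery} of the signals $x\in X\cap S^n$ if there is a decoder $f:\{-1,0,1\}^m\to S^n$ such that for every nonzero $x\in X\cap S^n$, $f(\operatorname{sign}(Mx))\ne0$ and $$\left\|\frac{x}{\|x\|_2}-\frac{f(\operatorname{sign}(Mx))}{\|f(\operatorname{sign}(Mx))\|_2}\right\|_2\le\varepsilon .$$ It is \emph{universal} for $k$-sparse $x\in S^n$ if this holds with $X$ the class of all $k$-sparse vectors. $M$ can be used for $\varepsilon$-approximate recovery of $k$-sparse signals \emph{within supersets of size $s$} if for each $T\subseteq[n]$ with $|T|\le s$ it can be used for $\varepsilon$-approximate recovery of the $k$-sparse $x\in\mathbb R^n$ with $\operatorname{supp}(x)\subseteq T$ (the decoder may depend on $T$). A $0/1$ matrix is \emph{$(k,l)$-list disjunct} if for any disjoint sets $S,T$ of columns with $|S|=k$, $|T|=l$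 some row has a nonzero entry in a column of $T$ and only zeros in the columns of $S$. A matrix $M$ and a signal $x$ have the \emph{no-cancellation property} if for every row $M_i$ the set $S_i=\operatorname{supp}(M_i)\cap\operatorname{supp}(x)$ is empty or $\sum_{j\in S_i}M_{ij}x_j\neq0$. \textbf{Corollary.} 1. If $M^{(1)}$ is a $(k,l)$-list disjunct matrix with $n$ columns and $x\in\mathbb R^n$ has nonnegative entries, then $M^{(1)}$ and $x$ have the no-cancellation property. 2. Let $\varepsilon>0$, let $M^{(1)}$ be a $(k,l)$-list disjunct matrix with $n$ columns, and let $M^{(2)}$ be a real matrix with $n$ columns that can be used for $\varepsilon$-approximate recovery of $k$-sparse signals within supersets of size $k+l$. Then $M=\begin{bmatrix}M^{(1)}\\M^{(2)}\end{bmatrix}$ can be used for universal $\varepsilon$-approximate recovery of $k$-sparse $x\in\mathbb R_{\ge0}^n$. 3. For each $c>0$ there is $C>0$ such that for all $1\le k\le n$, integers $0\le l\le ck$, $\varepsilon\in(0,1]$, $\eta\in(0,1)$ and $m_2\ge\frac{C}{\varepsilon}\left(k\log\frac{n^{3/2}}{k\varepsilon}+\log\frac1\eta\right)$, an $m_2\times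 n$ matrix with i.i.d. $\mathcal N(0,1)$ entries can, with probability at least $1-\eta$, be used for universal $\varepsilon$-approximate recovery of $(k+l)$-sparse $x\in\mathbb R^n$ (and hence serve as $M^{(2)}$ in part 2). 4. There are absolute constants $c,C>0$ such that for all $n\ge2$, $1\le k\le n$ and $\varepsilon\in(0,1]$ there are an integer $0\le l\le ck$ and matrices $M^{(1)}$, $M^{(2)}$ as in part 2 with at most $Ck\log\frac nk$ and $C\frac k\varepsilon\log\frac{n^{3/2}}{k\varepsilon}$ rows, respectively. In particular some matrix $M$ as in part 2 with $O\!\left(k\log\frac nk+\frac k\varepsilon\log\frac{n^{3/2}}{k\varepsilon}\right)$ rows can be used for universal $\varepsilon$-approximate recovery of $k$-sparse $x\in\mathbb R^n_{\ge0}$. -/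

import Mathlib

open MeasureTheory ProbabilityTheory

/-- The support of a signal `x ∈ ℝⁿ`: the set of indices of its nonzero entries. -/
noncomputable def signalSupport {n : ℕ} (x : EuclideanSpace ℝ (Fin n)) : Finset (Fin n) :=
  Finset.univ.filter fun j => x j ≠ 0

/-- `x` is `k`-sparse: `‖x‖₀ ≤ k`. -/
def IsSparse {n : ℕ} (k : ℕ) (x : EuclideanSpace ℝ (Fin n)) : Prop :=
  (signalSupport x).card ≤ k

/-- The one-bit measurement `sign (M x) ∈ {-1, 0, 1}^m`. -/
noncomputable def signMeasurement {ι : Type*} {n : ℕ} (M : Matrix ι (Fin n) ℝ)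
    (x : EuclideanSpace ℝ (Fin n)) : ι → SignType :=
  fun i => SignType.sign (∑ j, M i j * x j)

/-- There is a decoder `f : {-1, 0, 1}^m → Sⁿ` that recovers the direction of every nonzero signal
`x ∈ Sⁿ` of the class `X` up to Euclidean error `ε`. The decoded vector is required to be nonzero,
so that its normalization is meaningful. -/
def CanApproxRecover {ι : Type*} {n : ℕ} (S : Set ℝ) (X : Set (EuclideanSpace ℝ (Fin n)))
    (ε : ℝ) (M : Matrix ι (Fin n) ℝ) : Prop :=
  ∃ f : (ι → SignType) → EuclideanSpace ℝ (Fin n),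
    (∀ y j, f y j ∈ S) ∧
    ∀ x ∈ X, (∀ j, x j ∈ S) → x ≠ 0 →
      f (signMeasurement M x) ≠ 0 ∧
      ‖‖x‖⁻¹ • x - ‖f (signMeasurement M x)‖⁻¹ • f (signMeasurement M x)‖ ≤ ε

/-- `M` can be used for universal `ε`-approximate recovery of `k`-sparse `x ∈ Sⁿ`. -/
def IsUniversalApproxRecovery {ι : Type*} {n : ℕ} (S : Set ℝ) (k : ℕ) (ε : ℝ)
    (M : Matrix ι (Fin n) ℝ) : Prop :=
  CanApproxRecover S {x | IsSparse k x} ε M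

/-- `M` can be used for `ε`-approximate recovery of `k`-sparse real signals within any known
superset `T` of their support that has at most `s` elements; the decoder may depend on `T`. -/
def IsApproxRecoveryWithin {ι : Type*} {n : ℕ} (k s : ℕ) (ε : ℝ)
    (M : Matrix ι (Fin n) ℝ) : Prop :=
  ∀ T : Finset (Fin n), T.card ≤ s →
    CanApproxRecover Set.univ {x | IsSparse k x ∧ signalSupport x ⊆ T} ε M

/-- `M` is a binary `(k, l)`-list disjunct matrix: for disjoint sets `S`, `T` of `k` resp. `l`
columns, some row has a nonzero entry in a column of `T` and zeros in all columns of `S`. -/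
def IsListDisjunct {ι : Type*} {n : ℕ} (k l : ℕ) (M : Matrix ι (Fin n) ℝ) : Prop :=
  (∀ i j, M i j = 0 ∨ M i j = 1) ∧
  ∀ S T : Finset (Fin n), Disjoint S T → S.card = k → T.card = l →
    ∃ i, (∃ j ∈ T, M i j ≠ 0) ∧ ∀ j ∈ S, M i j = 0

/-- The no-cancellation property of `M` and `x`: for every row `i`, the set
`Sᵢ = supp Mᵢ ∩ supp x` is empty or the product of the restrictions to `Sᵢ` is nonzero. -/
def NoCancellation {ι : Type*} {n : ℕ} (M : Matrix ι (Fin n) ℝ)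
    (x : EuclideanSpace ℝ (Fin n)) : Prop :=
  ∀ i, (signalSupport x).filter (fun j => M i j ≠ 0) = ∅ ∨
    ∑ j ∈ (signalSupport x).filter (fun j => M i j ≠ 0), M i j * x j ≠ 0

/-- The law of an `m × n` matrix with i.i.d. standard Gaussian entries. -/
noncomputable def gaussianMatrixLaw (m n : ℕ) : Measure (Fin m → Fin n → ℝ) :=
  Measure.pi fun _ => Measure.pi fun _ => gaussianReal 0 1

/-! The binary part locates the support. For a nonnegative signal nothing cancels, so a binary row
measures 1 exactly when it meets the support. Discarding every column of every row that measures 0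
leaves a superset of the support, and list disjunctness caps its size at k + l
(`IsListDisjunct.candidates`). The superset decoder of the second part then finds the direction, and
its positive part is nonnegative and no farther from the signal (`nonnegPart_spec`).

For a Gaussian matrix it suffices that sparse unit vectors more than ε apart get different sign
patterns. A random hyperplane separates two vectors at distance at least ε / 2, together with small
balls around them, with probability of order ε (`le_stdGaussian_separates`). With s = k + l, a union
bound over pairs from a net of (n/ε)^{O(s)} points (`exists_net_sparse`) bounds the failure
probability by exp(O(s log(n/ε)) - Ω(ε m)). List disjunct matrices come from the same union bound,
applied to random Boolean rows of density 1/(2k). -/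

open scoped RealInnerProductSpace

/-! ### Union bound over independent rows, and one-dimensional Gaussian estimates -/

/-- Rows drawn independently from `ν`: the probability that some event of a finite family is missed
by all `m` rows decays exponentially in `m`. -/
theorem measure_pi_forall_notMem_le {Ω ι : Type*} [MeasurableSpace Ω] (ν : Measure Ω)
    [IsProbabilityMeasure ν] (m : ℕ) (I : Finset ι) (G : ι → Set Ω) (p : ℝ)
    (hG : ∀ i ∈ I, MeasurableSet (G i)) (hp : ∀ i ∈ I, p ≤ ν.real (G i)) :
    Measure.pi (fun _ : Fin m => ν) {A | ∃ i ∈ I, ∀ r, A r ∉ G i}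
      ≤ ENNReal.ofReal (I.card * Real.exp (-(p * m))) := by
  have hsub : {A : Fin m → Ω | ∃ i ∈ I, ∀ r, A r ∉ G i} ⊆
      ⋃ i ∈ I, Set.univ.pi fun _ => (G i)ᶜ := by
    rintro A ⟨i, hi, h⟩
    simp only [Set.mem_iUnion]
    exact ⟨i, hi, fun r _ => h r⟩
  have hone : ∀ i ∈ I, Measure.pi (fun _ : Fin m => ν) (Set.univ.pi fun _ => (G i)ᶜ)
      ≤ ENNReal.ofReal (Real.exp (-(p * m))) := by
    intro i hi
    have h1 : ν (G i)ᶜ ≤ ENNReal.ofReal (Real.exp (-p)) := by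
      rw [← ofReal_measureReal]
      apply ENNReal.ofReal_le_ofReal
      rw [probReal_compl_eq_one_sub (hG i hi)]
      have := Real.add_one_le_exp (-p)
      linarith [hp i hi]
    rw [Measure.pi_pi, Finset.prod_const, Finset.card_univ, Fintype.card_fin]
    calc ν (G i)ᶜ ^ m ≤ ENNReal.ofReal (Real.exp (-p)) ^ m := by gcongr
      _ = ENNReal.ofReal (Real.exp (-(p * m))) := by
        rw [← ENNReal.ofReal_pow (Real.exp_pos _).le, ← Real.exp_nat_mul]
        congr 2; ring
  calc _ ≤ _ := measure_mono hsub
    _ ≤ ∑ i ∈ I, Measure.pi (fun _ : Fin m => ν) (Set.univ.pi fun _ => (G i)ᶜ) :=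
      measure_biUnion_finset_le _ _
    _ ≤ ∑ _i ∈ I, ENNReal.ofReal (Real.exp (-(p * m))) := Finset.sum_le_sum hone
    _ = _ := by
      rw [Finset.sum_const, nsmul_eq_mul, ENNReal.ofReal_mul (by positivity),
        ENNReal.ofReal_natCast]

/-- The standard Gaussian density is at least `1 / 27` on `[-2, 2]`. -/
theorem sub_div_le_gaussianReal_Icc {a b : ℝ} (ha : -2 ≤ a) (hab : a ≤ b) (hb : b ≤ 2) :
    (b - a) / 27 ≤ (gaussianReal 0 1).real (Set.Icc a b) := by
  rw [measureReal_def, gaussianReal_apply_eq_integral _ one_ne_zero,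
    ENNReal.toReal_ofReal (integral_nonneg fun x => gaussianPDFReal_nonneg _ _ _)]
  -- The density is at least e⁻² / √(2π) here, and 27 = 3 · 9 with √(2π) ≤ 3 and e² ≤ 9.
  have h : ∀ x ∈ Set.Icc a b, (1 / 27 : ℝ) ≤ gaussianPDFReal 0 1 x := by
    rintro x ⟨h1, h2⟩
    have hs : √(2 * Real.pi * (1 : NNReal)) ≤ 3 := by
      rw [Real.sqrt_le_left (by norm_num)]
      have := Real.pi_lt_d2
      norm_num; linarith
    have hs0 : 0 < √(2 * Real.pi * (1 : NNReal)) := by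
      apply Real.sqrt_pos.2
      have := Real.pi_pos
      norm_num; linarith
    have he : (1 / 9 : ℝ) ≤ Real.exp (-(x - 0) ^ 2 / (2 * (1 : NNReal))) := by
      have h3 : Real.exp 2 ≤ 9 := by
        have : Real.exp 2 = Real.exp 1 * Real.exp 1 := by rw [← Real.exp_add]; norm_num
        have h4 := Real.exp_one_lt_d9
        have h5 := Real.exp_pos 1
        nlinarith
      calc (1 / 9 : ℝ) ≤ (Real.exp 2)⁻¹ := by
            rw [one_div]; exact inv_anti₀ (Real.exp_pos 2) h3
        _ = Real.exp (-2) := (Real.exp_neg 2).symm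
        _ ≤ _ := by
            apply Real.exp_le_exp.2
            norm_num
            nlinarith
    rw [gaussianPDFReal]
    calc (1 / 27 : ℝ) = 3⁻¹ * (1 / 9) := by norm_num
      _ ≤ _ := by gcongr
  calc (b - a) / 27 = ∫ _ in Set.Icc a b, (1 / 27 : ℝ) := by
        rw [setIntegral_const, measureReal_def, Real.volume_Icc,
          ENNReal.toReal_ofReal (by linarith), smul_eq_mul]
        ring
    _ ≤ _ := by
        apply setIntegral_mono_on _ (integrable_gaussianPDFReal 0 1).integrableOn
          measurableSet_Icc h
        exact integrableOn_const (by simp)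

/-- Scaling a standard Gaussian by √v ≤ 2 sends [-t/2, t/2] into [-t, t]. Arguing by scaling rather
than by density also covers v = 0. -/
theorem half_div_le_gaussianReal_abs_le {v : NNReal} (hv : v ≤ 4) {t : ℝ} (ht : 0 ≤ t) (ht' : t ≤ 2) :
    t / 27 ≤ (gaussianReal 0 v).real {x | |x| ≤ t} := by
  have hmap : gaussianReal 0 v = (gaussianReal 0 1).map (√(v : ℝ) * ·) := by
    rw [gaussianReal_map_const_mul]
    congr 1
    · simp
    · ext; simp
  have hms : MeasurableSet {x : ℝ | |x| ≤ t} := measurableSet_le (by fun_prop) (by fun_prop)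
  rw [hmap, map_measureReal_apply (by fun_prop) hms]
  have hs : √(v : ℝ) ≤ 2 := by
    rw [Real.sqrt_le_left (by norm_num)]
    have : (v : ℝ) ≤ 4 := by exact_mod_cast hv
    linarith
  calc t / 27 = (t / 2 - -(t / 2)) / 27 := by ring
    _ ≤ _ := sub_div_le_gaussianReal_Icc (by linarith) (by linarith) (by linarith)
    _ ≤ _ := by
      apply measureReal_mono _ (by finiteness)
      rintro x ⟨h1, h2⟩
      simp only [Set.mem_preimage, Set.mem_ofPred_eq, abs_mul, abs_of_nonneg (Real.sqrt_nonneg _)]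
      have : |x| ≤ t / 2 := abs_le.2 ⟨h1, h2⟩
      nlinarith [abs_nonneg x]

/-- A standard Gaussian lies in [1, 2] with probability at least 1/27; scale by d, which may be 0.
-/
theorem inv_le_gaussianReal_le {d : ℝ} (hd : 0 ≤ d) :
    1 / 27 ≤ (gaussianReal 0 (d ^ 2).toNNReal).real {x | d ≤ x} := by
  have hmap : gaussianReal 0 (d ^ 2).toNNReal = (gaussianReal 0 1).map (d * ·) := by
    rw [gaussianReal_map_const_mul]
    congr 1
    · simp
    · ext; simp [sq_nonneg]
  rw [hmap, map_measureReal_apply (by fun_prop) (measurableSet_le (by fun_prop) (by fun_prop))]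
  calc (1 / 27 : ℝ) = (2 - 1) / 27 := by norm_num
    _ ≤ _ := sub_div_le_gaussianReal_Icc (by norm_num) (by norm_num) (by norm_num)
    _ ≤ _ := by
      apply measureReal_mono _ (by finiteness)
      rintro x ⟨h1, h2⟩
      simp only [Set.mem_preimage, Set.mem_ofPred_eq]
      nlinarith

/-! ### Separation by Gaussian hyperplanes -/

section StdGaussian

variable {E : Type*} [NormedAddCommGroup E] [InnerProductSpace ℝ E] [FiniteDimensional ℝ E]
  [MeasurableSpace E] [BorelSpace E]

theorem stdGaussian_map_inner (u : E) :
    (stdGaussian E).map (fun a => ⟪u, a⟫) = gaussianReal 0 (‖u‖ ^ 2).toNNReal := by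
  have h : HasGaussianLaw (fun a => ⟪u, a⟫) (stdGaussian E) :=
    (IsGaussian.hasGaussianLaw_id (μ := stdGaussian E)).map_fun (innerSL ℝ u)
  rw [h.map_eq_gaussianReal]
  have h1 := integral_strongDual_stdGaussian (innerSL ℝ u)
  have h2 := variance_dual_stdGaussian (innerSL ℝ u)
  simp only [innerSL_apply_apply, innerSL_apply_norm] at h1 h2
  have h2' : Var[fun a => ⟪u, a⟫; stdGaussian E] = ‖u‖ ^ 2 := h2
  rw [h1, h2']

/-- The two functionals are jointly Gaussian with covariance ⟪u, v⟫, so orthogonality makes them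
independent. -/
theorem indepFun_inner_stdGaussian {u v : E} (huv : ⟪u, v⟫ = 0) :
    IndepFun (fun a => ⟪u, a⟫) (fun a => ⟪v, a⟫) (stdGaussian E) := by
  apply HasGaussianLaw.indepFun_of_covariance_eq_zero
  · exact (IsGaussian.hasGaussianLaw_id (μ := stdGaussian E)).map_fun
      ((innerSL ℝ u).prod (innerSL ℝ v))
  · rw [← covarianceBilin_apply_eq_cov, covarianceBilin_stdGaussian]
    · exact huv
    · exact IsGaussian.memLp_two_id

/-- Markov's inequality for ‖a‖², whose mean is the dimension. -/
theorem stdGaussian_lt_norm_le {R : ℝ} (hR : 0 < R) :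
    (stdGaussian E).real {a | R < ‖a‖} ≤ Module.finrank ℝ E / R ^ 2 := by
  let b := stdOrthonormalBasis ℝ E
  have hL (i) : MemLp (fun a => ⟪b i, a⟫) 2 (stdGaussian E) :=
    ((IsGaussian.hasGaussianLaw_id (μ := stdGaussian E)).map_fun (innerSL ℝ (b i))).memLp_two
  have hint : ∫ a, ‖a‖ ^ 2 ∂(stdGaussian E) = Module.finrank ℝ E := by
    have h1 (i) : ∫ a, ⟪b i, a⟫ ^ 2 ∂(stdGaussian E) = 1 := by
      have h1 := integral_strongDual_stdGaussian (innerSL ℝ (b i))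
      have h2 := variance_dual_stdGaussian (innerSL ℝ (b i))
      simp only [innerSL_apply_apply, innerSL_apply_norm] at h1 h2
      have h2' : Var[fun a => ⟪b i, a⟫; stdGaussian E] = ‖b i‖ ^ 2 := h2
      rw [variance_of_integral_eq_zero (hL i).aemeasurable h1] at h2'
      simpa using h2'
    calc ∫ a, ‖a‖ ^ 2 ∂(stdGaussian E) = ∫ a, ∑ i, ⟪b i, a⟫ ^ 2 ∂(stdGaussian E) := by
          congr with a
          rw [← b.sum_sq_norm_inner_right a]
          simp
      _ = ∑ i, ∫ a, ⟪b i, a⟫ ^ 2 ∂(stdGaussian E) :=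
          integral_finsetSum _ fun i _ => (hL i).integrable_sq
      _ = _ := by simp [h1]
  have hmem : MemLp (id : E → E) 2 (stdGaussian E) := IsGaussian.memLp_two_id
  have hm := mul_meas_ge_le_integral_of_nonneg (μ := stdGaussian E) (f := fun a => ‖a‖ ^ 2)
    (Filter.Eventually.of_forall fun a => by positivity) (by simpa using hmem.norm.integrable_sq) (R ^ 2)
  rw [hint] at hm
  rw [le_div_iff₀ (by positivity), mul_comm]
  refine le_trans ?_ hm
  refine mul_le_mul_of_nonneg_left (measureReal_mono ?_ (by finiteness)) (by positivity)
  rintro a (ha : R < ‖a‖)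
  exact pow_le_pow_left₀ hR.le ha.le 2

/-- A Gaussian hyperplane separates two unit vectors at distance at least `ε / 2`, together with
small balls around them, with probability proportional to `ε`. -/
theorem le_stdGaussian_separates {x y : E} (hx : ‖x‖ = 1) (hy : ‖y‖ = 1) {ε δ : ℝ} (hε : 0 < ε)
    (hε1 : ε ≤ 1) (hxy : ε / 2 ≤ ‖x - y‖) (hδ : 0 ≤ δ)
    (hδ' : δ * (1000 * Module.finrank ℝ E) ≤ ε ^ 2) :
    ε / 6000 ≤ (stdGaussian E).real {a | δ * ‖a‖ < ⟪x, a⟫ ∧ ⟪y, a⟫ < -(δ * ‖a‖)} := by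
  set d := ‖x - y‖ with hd
  set γ := stdGaussian E
  have hd2 : d ≤ 2 := by
    calc d ≤ ‖x‖ + ‖y‖ := norm_sub_le _ _
      _ = 2 := by rw [hx, hy]; norm_num
  have hv : ‖x + y‖ ≤ 2 := by
    calc ‖x + y‖ ≤ ‖x‖ + ‖y‖ := norm_add_le _ _
      _ = 2 := by rw [hx, hy]; norm_num
  -- Equal norms make difference and sum orthogonal, hence independent as Gaussian functionals. If
  -- the first is at least d and the second at most d/2 in absolute value, then ⟪x, a⟫ ≥ d/4 and ⟪y,
  -- a⟫ ≤ -d/4.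
  have horth : ⟪x - y, x + y⟫ = 0 := by
    rw [inner_sub_left, inner_add_right, inner_add_right, real_inner_self_eq_norm_sq,
      real_inner_self_eq_norm_sq, hx, hy, real_inner_comm x y]
    ring
  have hn : (1 : ℝ) ≤ Module.finrank ℝ E := by
    have : Nontrivial E := ⟨x, 0, by rintro rfl; simp at hx⟩
    exact_mod_cast Module.finrank_pos
  set n : ℝ := ((Module.finrank ℝ E : ℕ) : ℝ) with hndef
  -- This radius makes the tail at most ε/10000 and keeps δR ≤ ε/10 < d/4. What remains is ε/2916 -
  -- ε/10000 ≥ ε/6000.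
  set R : ℝ := 100 * n / ε with hRdef
  have hR : 0 < R := by positivity
  have hU : 1 / 27 ≤ γ.real ((fun a => ⟪x - y, a⟫) ⁻¹' {t | d ≤ t}) := by
    rw [← map_measureReal_apply (by fun_prop) (measurableSet_le (by fun_prop) (by fun_prop)),
      stdGaussian_map_inner]
    exact inv_le_gaussianReal_le (norm_nonneg _)
  have hV : d / 2 / 27 ≤ γ.real ((fun a => ⟪x + y, a⟫) ⁻¹' {t | |t| ≤ d / 2}) := by
    rw [← map_measureReal_apply (by fun_prop) (measurableSet_le (by fun_prop) (by fun_prop)),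
      stdGaussian_map_inner]
    apply half_div_le_gaussianReal_abs_le _ (by positivity) (by linarith)
    rw [Real.toNNReal_le_iff_le_coe]
    norm_num
    nlinarith [norm_nonneg (x + y)]
  have hUV : 1 / 27 * (d / 2 / 27) ≤ γ.real
      ((fun a => ⟪x - y, a⟫) ⁻¹' {t | d ≤ t} ∩ (fun a => ⟪x + y, a⟫) ⁻¹' {t | |t| ≤ d / 2}) := by
    have h := (indepFun_inner_stdGaussian horth).measure_inter_preimage_eq_mul {t | d ≤ t}
      {t | |t| ≤ d / 2} (measurableSet_le (by fun_prop) (by fun_prop))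
      (measurableSet_le (by fun_prop) (by fun_prop))
    rw [measureReal_def, h, ENNReal.toReal_mul]
    exact mul_le_mul hU hV (by positivity) measureReal_nonneg
  have htail := stdGaussian_lt_norm_le (E := E) hR
  have hsub : (fun a => ⟪x - y, a⟫) ⁻¹' {t | d ≤ t} ∩ (fun a => ⟪x + y, a⟫) ⁻¹' {t | |t| ≤ d / 2} ⊆
      {a | δ * ‖a‖ < ⟪x, a⟫ ∧ ⟪y, a⟫ < -(δ * ‖a‖)} ∪ {a | R < ‖a‖} := by
    rintro a ⟨h1, h2⟩
    simp only [Set.mem_preimage, Set.mem_ofPred_eq, inner_sub_left, inner_add_left, abs_le] at h1 h2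
    by_cases ha : R < ‖a‖
    · exact Or.inr ha
    left
    have h3 : δ * ‖a‖ < d / 4 := by
      have : δ * R ≤ ε / 10 := by
        rw [hRdef, mul_div_assoc', div_le_iff₀ hε]
        nlinarith
      have : δ * ‖a‖ ≤ δ * R := mul_le_mul_of_nonneg_left (not_lt.1 ha) hδ
      linarith
    constructor <;> linarith
  have hle := (measureReal_mono (μ := γ) hsub (by finiteness)).trans (measureReal_union_le _ _)
  have hs : n / R ^ 2 ≤ ε / 10000 := by
    rw [hRdef, div_le_div_iff₀ (by positivity) (by norm_num), div_pow, mul_div_assoc',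
      le_div_iff₀ (by positivity)]
    have : ε * n ≤ n * n := by nlinarith
    nlinarith [mul_le_mul_of_nonneg_left this hε.le]
  linarith

end StdGaussian

/-! ### Deterministic recovery: decoders, candidate columns, positive parts, nets -/

section Recovery

variable {ι : Type*} {n : ℕ}

theorem mem_signalSupport {x : EuclideanSpace ℝ (Fin n)} {j : Fin n} :
    j ∈ signalSupport x ↔ x j ≠ 0 := by
  simp [signalSupport]

theorem signalSupport_smul {c : ℝ} (hc : c ≠ 0) (x : EuclideanSpace ℝ (Fin n)) :
    signalSupport (c • x) = signalSupport x := by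
  ext j
  simp [mem_signalSupport, hc]

theorem signMeasurement_smul {c : ℝ} (hc : 0 < c) (M : Matrix ι (Fin n) ℝ)
    (x : EuclideanSpace ℝ (Fin n)) : signMeasurement M (c • x) = signMeasurement M x := by
  funext i
  have : ∑ j, M i j * (c • x) j = c * ∑ j, M i j * x j := by
    rw [Finset.mul_sum]
    refine Finset.sum_congr rfl fun j _ => ?_
    simp; ring
  simp only [signMeasurement]
  rw [this, sign_mul, sign_pos hc, one_mul]

theorem IsSparse.mono {k k' : ℕ} (h : k ≤ k') {x : EuclideanSpace ℝ (Fin n)} (hx : IsSparse k x) :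
    IsSparse k' x :=
  le_trans hx h

/-- Universal recovery of sparse signals is possible as soon as sparse unit vectors with the same
measurement are close. -/
theorem isUniversalApproxRecovery_of_dist_le {s : ℕ} {ε : ℝ} {M : Matrix ι (Fin n) ℝ}
    (h : ∀ x y : EuclideanSpace ℝ (Fin n), ‖x‖ = 1 → ‖y‖ = 1 → IsSparse s x → IsSparse s y →
      signMeasurement M x = signMeasurement M y → ‖x - y‖ ≤ ε) :
    IsUniversalApproxRecovery Set.univ s ε M := by
  classical
  -- Decode to any nonzero sparse signal with the observed signs; the default 0 never occurs on an
  -- actual measurement.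
  refine ⟨fun z => if hz : ∃ x, x ≠ 0 ∧ IsSparse s x ∧ signMeasurement M x = z then hz.choose else 0,
    fun _ _ => Set.mem_univ _, fun x (hx : IsSparse s x) _ hx0 => ?_⟩
  have hz : ∃ x', x' ≠ 0 ∧ IsSparse s x' ∧ signMeasurement M x' = signMeasurement M x :=
    ⟨x, hx0, hx, rfl⟩
  simp only [dif_pos hz]
  obtain ⟨h1, h2, h3⟩ := hz.choose_spec
  have hpos : ∀ y : EuclideanSpace ℝ (Fin n), y ≠ 0 → 0 < ‖y‖⁻¹ := fun y hy =>
    inv_pos.2 (norm_pos_iff.2 hy)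
  refine ⟨h1, h _ _ (norm_smul_inv_norm hx0) (norm_smul_inv_norm h1) ?_ ?_ ?_⟩
  · rw [IsSparse, signalSupport_smul (hpos _ hx0).ne']; exact hx
  · rw [IsSparse, signalSupport_smul (hpos _ h1).ne']; exact h2
  · rw [signMeasurement_smul (hpos _ hx0), signMeasurement_smul (hpos _ h1), h3]

theorem IsUniversalApproxRecovery.isApproxRecoveryWithin {k s s' : ℕ} (hk : k ≤ s) {ε : ℝ}
    {M : Matrix ι (Fin n) ℝ} (h : IsUniversalApproxRecovery Set.univ s ε M) :
    IsApproxRecoveryWithin k s' ε M := by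
  obtain ⟨f, hf, hf'⟩ := h
  exact fun T _ => ⟨f, hf, fun x hx => hf' x (IsSparse.mono hk hx.1)⟩

theorem IsListDisjunct.noCancellation {k l : ℕ} {M : Matrix ι (Fin n) ℝ}
    {x : EuclideanSpace ℝ (Fin n)} (hM : IsListDisjunct k l M) (hx : ∀ j, 0 ≤ x j) :
    NoCancellation M x := by
  intro i
  rcases Finset.eq_empty_or_nonempty ((signalSupport x).filter fun j => M i j ≠ 0) with h | h
  · exact Or.inl h
  · refine Or.inr (Finset.sum_pos (fun j hj => ?_) h).ne'
    obtain ⟨h1, h2⟩ := Finset.mem_filter.1 hj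
    rw [(hM.1 i j).resolve_left h2, one_mul]
    exact lt_of_le_of_ne (hx j) (mem_signalSupport.1 h1).symm

/-- The columns that are not ruled out by the measurement of a nonnegative `k`-sparse signal with a
list disjunct matrix: they contain the support, and there are at most `k + l` of them. -/
theorem IsListDisjunct.candidates {k l : ℕ} {M : Matrix ι (Fin n) ℝ} (hM : IsListDisjunct k l M)
    {x : EuclideanSpace ℝ (Fin n)} (hx : ∀ j, 0 ≤ x j) (hk : IsSparse k x) {P : Finset (Fin n)}
    (hP : ∀ j, j ∈ P ↔ ∀ i, M i j ≠ 0 → signMeasurement M x i = 1) :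
    signalSupport x ⊆ P ∧ P.card ≤ k + l := by
  have hsub : signalSupport x ⊆ P := by
    intro j hj
    rw [hP]
    intro i hij
    apply sign_pos
    apply Finset.sum_pos' _ ⟨j, Finset.mem_univ _, _⟩
    · intro j' _
      apply mul_nonneg _ (hx j')
      rcases hM.1 i j' with h | h <;> norm_num [h]
    · rw [(hM.1 i j).resolve_left hij, one_mul]
      exact lt_of_le_of_ne (hx j) (mem_signalSupport.1 hj).symm
  refine ⟨hsub, ?_⟩
  by_contra! hcard
  -- Enlarge the support inside `P` to exactly k columns; at least l + 1 candidates remain, from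
  -- which `T` is taken. The row that meets `T` and avoids `S` measures 0, yet it contains a
  -- candidate column, so it should measure 1.
  obtain ⟨S, hS1, hS2, hS3⟩ := Finset.exists_subsuperset_card_eq hsub hk (by omega)
  obtain ⟨T, hT1, hT2⟩ := Finset.exists_subset_card_eq (s := P \ S) (n := l) (by
    rw [Finset.card_sdiff_of_subset hS2]; omega)
  obtain ⟨i, ⟨j, hj, hij⟩, hi⟩ := hM.2 S T
    (Finset.disjoint_of_subset_right hT1 Finset.disjoint_sdiff) hS3 hT2
  have h1 := (hP j).1 (Finset.mem_sdiff.1 (hT1 hj)).1 i hij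
  have h0 : ∑ j, M i j * x j = 0 := by
    refine Finset.sum_eq_zero fun j' _ => ?_
    by_cases hj' : x j' = 0
    · rw [hj', mul_zero]
    · rw [hi j' (hS1 (mem_signalSupport.2 hj')), zero_mul]
  rw [signMeasurement, h0] at h1
  simp at h1

/-- The coordinatewise positive part of a signal, or the all-ones signal where this vanishes. -/
noncomputable def nonnegPart (u : EuclideanSpace ℝ (Fin n)) : EuclideanSpace ℝ (Fin n) :=
  open Classical in
  if WithLp.toLp 2 (fun j => max (u j) 0) = 0 then WithLp.toLp 2 fun _ => 1
  else WithLp.toLp 2 fun j => max (u j) 0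

theorem nonnegPart_nonneg (u : EuclideanSpace ℝ (Fin n)) (j : Fin n) : 0 ≤ nonnegPart u j := by
  unfold nonnegPart
  split_ifs <;> simp

/-- Among unit vectors, the squared distance to x depends only on the inner product with x, and
decreases in it. -/
theorem norm_sub_le_of_inner_le {x a b : EuclideanSpace ℝ (Fin n)} (ha : ‖a‖ = 1) (hb : ‖b‖ = 1)
    (h : ⟪x, a⟫ ≤ ⟪x, b⟫) : ‖x - b‖ ≤ ‖x - a‖ := by
  apply (pow_le_pow_iff_left₀ (norm_nonneg _) (norm_nonneg _) two_ne_zero).1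
  rw [norm_sub_sq_real, norm_sub_sq_real, ha, hb]
  linarith

/-- Replacing a decoded signal by its positive part does not increase the error. -/
theorem nonnegPart_spec {x u : EuclideanSpace ℝ (Fin n)} (hx : ∀ j, 0 ≤ x j) (hx0 : x ≠ 0)
    (hu : u ≠ 0) : nonnegPart u ≠ 0 ∧
      ‖‖x‖⁻¹ • x - ‖nonnegPart u‖⁻¹ • nonnegPart u‖ ≤ ‖‖x‖⁻¹ • x - ‖u‖⁻¹ • u‖ := by
  set v : EuclideanSpace ℝ (Fin n) := WithLp.toLp 2 fun j => max (u j) 0 with hv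
  have hne : nonnegPart u ≠ 0 := by
    unfold nonnegPart
    split_ifs with h
    · obtain ⟨j, hj⟩ : ∃ j, x j ≠ 0 := by
        by_contra! h'
        exact hx0 (by ext j; simp [h' j])
      intro h0
      have := congrArg (fun y : EuclideanSpace ℝ (Fin n) => y j) h0
      simp at this
    · exact h
  refine ⟨hne, norm_sub_le_of_inner_le (norm_smul_inv_norm hu) (norm_smul_inv_norm hne) ?_⟩
  rw [real_inner_smul_left, real_inner_smul_left, real_inner_smul_right, real_inner_smul_right]
  apply mul_le_mul_of_nonneg_left _ (by positivity)
  have hnn : ∀ w : EuclideanSpace ℝ (Fin n), (∀ j, 0 ≤ w j) → 0 ≤ ⟪x, w⟫ := fun w hw => by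
    rw [PiLp.inner_apply]
    exact Finset.sum_nonneg fun j _ => by simpa using mul_nonneg (hw j) (hx j)
  have huv : ⟪x, u⟫ ≤ ⟪x, v⟫ := by
    rw [PiLp.inner_apply, PiLp.inner_apply]
    refine Finset.sum_le_sum fun j _ => ?_
    simpa [hv] using mul_le_mul_of_nonneg_right (le_max_left (u j) 0) (hx j)
  -- If the positive part vanishes, ⟪x, u⟫ ≤ 0 and any nonnegative nonzero substitute does at least
  -- as well. Otherwise truncation raises the inner product with x and does not raise the norm.
  by_cases h : v = 0
  · rw [h, inner_zero_right] at huv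
    calc ‖u‖⁻¹ * ⟪x, u⟫ ≤ 0 := mul_nonpos_of_nonneg_of_nonpos (by positivity) huv
      _ ≤ _ := mul_nonneg (by positivity) (hnn _ (nonnegPart_nonneg u))
  · have hvp : nonnegPart u = v := by
      unfold nonnegPart
      rw [if_neg h]
    rw [hvp]
    have hle : ‖v‖ ≤ ‖u‖ := by
      rw [EuclideanSpace.norm_eq, EuclideanSpace.norm_eq]
      apply Real.sqrt_le_sqrt
      refine Finset.sum_le_sum fun j _ => ?_
      gcongr
      simp only [hv, Real.norm_eq_abs]
      rw [abs_of_nonneg (le_max_right _ _)]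
      exact max_le (le_abs_self _) (abs_nonneg _)
    have h0 : 0 < ‖v‖ := norm_pos_iff.2 h
    calc ‖u‖⁻¹ * ⟪x, u⟫ ≤ ‖u‖⁻¹ * ⟪x, v⟫ := by gcongr
      _ ≤ ‖v‖⁻¹ * ⟪x, v⟫ := by
        apply mul_le_mul_of_nonneg_right (inv_anti₀ h0 hle) (hnn _ fun j => ?_)
        simp [hv]

theorem IsListDisjunct.isUniversalApproxRecovery_fromRows {κ : Type*} {k l : ℕ} {ε : ℝ}
    {M₁ : Matrix ι (Fin n) ℝ} {M₂ : Matrix κ (Fin n) ℝ} (h₁ : IsListDisjunct k l M₁)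
    (h₂ : IsApproxRecoveryWithin k (k + l) ε M₂) :
    IsUniversalApproxRecovery (Set.Ici 0) k ε (Matrix.fromRows M₁ M₂) := by
  classical
  choose g _ hg using h₂
  let P : (ι ⊕ κ → SignType) → Finset (Fin n) := fun z =>
    Finset.univ.filter fun j => ∀ i, M₁ i j ≠ 0 → z (Sum.inl i) = 1
  -- The value 0 for oversized candidate sets is never used on a measurement of a nonnegative
  -- k-sparse signal.
  refine ⟨fun z => nonnegPart (if h : (P z).card ≤ k + l then g (P z) h (z ∘ Sum.inr) else 0),
    fun z j => nonnegPart_nonneg _ _, fun x hk hx hx0 => ?_⟩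
  obtain ⟨hsub, hcard⟩ := h₁.candidates (P := P (signMeasurement (Matrix.fromRows M₁ M₂) x)) hx hk
    (fun j => by simp only [P, Finset.mem_filter, Finset.mem_univ, true_and]; rfl)
  simp only [dif_pos hcard]
  obtain ⟨hu, hle⟩ := hg _ hcard x ⟨hk, hsub⟩ (fun _ => Set.mem_univ _) hx0
  obtain ⟨h3, h4⟩ := nonnegPart_spec hx hx0 hu
  exact ⟨h3, h4.trans hle⟩

/-- A finite net of unit vectors for the sparse unit vectors, obtained by rounding coordinates. -/
theorem exists_net_sparse (n s N : ℕ) (hN : 0 < N) :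
    ∃ F : Finset (EuclideanSpace ℝ (Fin n)), F.card ≤ (n * (2 * N + 1)) ^ s ∧
      (∀ p ∈ F, ‖p‖ = 1) ∧
      ∀ x : EuclideanSpace ℝ (Fin n), ‖x‖ = 1 → IsSparse s x → ∃ p ∈ F, ‖x - p‖ ≤ n / N := by
  classical
  -- A code lists s positions covering the support and the rounded values there. Vectors sharing a
  -- code differ by at most 1/N in each coordinate.
  let Enc : (Fin s → Fin n × Finset.Icc (-(N : ℤ)) N) → EuclideanSpace ℝ (Fin n) → Prop := fun c x =>
    (∀ j, x j ≠ 0 → ∃ i, (c i).1 = j) ∧ ∀ i, ((c i).2 : ℤ) = ⌊N * x (c i).1⌋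
  have hN' : (0 : ℝ) < N := by exact_mod_cast hN
  have henc : ∀ x : EuclideanSpace ℝ (Fin n), ‖x‖ = 1 → IsSparse s x → ∃ c, Enc c x := by
    intro x hx hs
    have hb (j) : ⌊N * x j⌋ ∈ Finset.Icc (-(N : ℤ)) N := by
      have h1 : |x j| ≤ 1 := by
        have := PiLp.norm_apply_le x j
        rwa [hx, Real.norm_eq_abs] at this
      obtain ⟨h2, h3⟩ := abs_le.1 h1
      rw [Finset.mem_Icc]
      refine ⟨Int.le_floor.2 ?_, ?_⟩
      · push_cast; nlinarith
      · have : (⌊N * x j⌋ : ℝ) ≤ N := (Int.floor_le _).trans (by nlinarith)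
        exact_mod_cast this
    obtain ⟨j₀⟩ : Nonempty (Fin n) := by
      by_contra h
      rw [not_nonempty_iff] at h
      rw [Subsingleton.elim x 0, norm_zero] at hx
      exact zero_ne_one hx
    let T := signalSupport x
    -- Supports smaller than s are padded with repetitions of `j₀`.
    let p : Fin s → Fin n := fun i =>
      if h : (i : ℕ) < T.card then (T.equivFin.symm ⟨i, h⟩ : Fin n) else j₀
    refine ⟨fun i => (p i, ⟨_, hb (p i)⟩), fun j hj => ?_, fun i => rfl⟩
    have hj' : j ∈ T := mem_signalSupport.2 hj
    refine ⟨⟨T.equivFin ⟨j, hj'⟩, (T.equivFin ⟨j, hj'⟩).2.trans_le hs⟩, ?_⟩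
    simp [p]
  have hclose : ∀ c x y, Enc c x → Enc c y → ‖x - y‖ ≤ n / N := by
    intro c x y hx hy
    have hj (j) : ‖(x - y) j‖ ≤ 1 / N := by
      rw [PiLp.sub_apply, Real.norm_eq_abs]
      by_cases h : ∃ i, (c i).1 = j
      · obtain ⟨i, rfl⟩ := h
        have := Int.abs_sub_lt_one_of_floor_eq_floor ((hx.2 i).symm.trans (hy.2 i))
        rw [← mul_sub, abs_mul, abs_of_pos hN'] at this
        rw [le_div_iff₀ hN']
        linarith
      · have h1 : x j = 0 := by by_contra h1; exact h (hx.1 j h1)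
        have h2 : y j = 0 := by by_contra h1; exact h (hy.1 j h1)
        simp [h1, h2]
    calc ‖x - y‖ ≤ ∑ j, ‖(x - y) j‖ := by
          conv_lhs => rw [← (EuclideanSpace.basisFun (Fin n) ℝ).sum_repr (x - y)]
          refine (norm_sum_le _ _).trans (Finset.sum_le_sum fun j _ => ?_)
          rw [norm_smul]
          simp
      _ ≤ ∑ _j : Fin n, 1 / (N : ℝ) := Finset.sum_le_sum fun j _ => hj j
      _ = n / N := by simp [div_eq_mul_inv]
  -- Representing each attained code by a unit vector, rather than by the rounded vector, keeps the
  -- net on the sphere.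
  choose rep hrep using fun c : {c // ∃ x, ‖x‖ = 1 ∧ Enc c x} => c.2
  refine ⟨Finset.univ.image rep, ?_, ?_, fun x hx hs => ?_⟩
  · calc _ ≤ Fintype.card {c // ∃ x, ‖x‖ = 1 ∧ Enc c x} := Finset.card_image_le
      _ ≤ Fintype.card (Fin s → Fin n × Finset.Icc (-(N : ℤ)) N) := Fintype.card_subtype_le _
      _ = _ := by
        simp only [Fintype.card_fun, Fintype.card_prod, Fintype.card_fin, Fintype.card_coe,
          Int.card_Icc]
        congr 2
        omega
  · intro p hp
    obtain ⟨c, -, rfl⟩ := Finset.mem_image.1 hp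
    exact (hrep c).1
  · obtain ⟨c, hc⟩ := henc x hx hs
    exact ⟨rep ⟨c, x, hx, hc⟩, Finset.mem_image_of_mem _ (Finset.mem_univ _),
      hclose c _ _ hc (hrep ⟨c, x, hx, hc⟩).2⟩

end Recovery

/-! ### Gaussian matrices recover sparse signals -/

theorem signMeasurement_eq_sign_inner {ι : Type*} {n : ℕ} (M : Matrix ι (Fin n) ℝ)
    (x : EuclideanSpace ℝ (Fin n)) (i : ι) :
    signMeasurement M x i = SignType.sign ⟪x, WithLp.toLp 2 (M i)⟫ := by
  simp [signMeasurement, PiLp.inner_apply]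

instance isProbabilityMeasure_gaussianMatrixLaw (m n : ℕ) :
    IsProbabilityMeasure (gaussianMatrixLaw m n) := by
  unfold gaussianMatrixLaw
  infer_instance

/-- Union bound over net pairs at distance at least ε/2. The condition on `N` makes the net radius
n/N small enough for rows to separate whole balls around the net points. -/
theorem gaussianMatrixLaw_not_recovery_le {n s m N : ℕ} (hN : 0 < N) {ε : ℝ} (hε : 0 < ε)
    (hε1 : ε ≤ 1) (hNε : 1000 * (n : ℝ) ^ 2 ≤ ε ^ 2 * N) :
    gaussianMatrixLaw m n {A | ¬ IsUniversalApproxRecovery Set.univ s ε (Matrix.of A)}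
      ≤ ENNReal.ofReal (((n * (2 * N + 1) : ℕ) : ℝ) ^ (2 * s) * Real.exp (-(ε / 6000 * m))) := by
  classical
  obtain ⟨F, hcard, hF1, hF⟩ := exists_net_sparse n s N hN
  have hN' : (0 : ℝ) < N := by exact_mod_cast hN
  set δ : ℝ := n / N with hδ
  have hδ0 : 0 ≤ δ := by positivity
  have hδn : δ * (1000 * n) ≤ ε ^ 2 := by
    rw [hδ, div_mul_eq_mul_div, div_le_iff₀ hN']
    nlinarith
  let I : Finset (EuclideanSpace ℝ (Fin n) × EuclideanSpace ℝ (Fin n)) :=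
    (F ×ˢ F).filter fun q => ε / 2 ≤ ‖q.1 - q.2‖
  let G : EuclideanSpace ℝ (Fin n) × EuclideanSpace ℝ (Fin n) → Set (EuclideanSpace ℝ (Fin n)) :=
    fun q => {a | δ * ‖a‖ < ⟪q.1, a⟫ ∧ ⟪q.2, a⟫ < -(δ * ‖a‖)}
  have hG (q) : MeasurableSet (G q) := by
    have h1 : MeasurableSet {a | δ * ‖a‖ < ⟪q.1, a⟫} := measurableSet_lt (by fun_prop) (by fun_prop)
    have h2 : MeasurableSet {a | ⟪q.2, a⟫ < -(δ * ‖a‖)} :=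
      measurableSet_lt (by fun_prop) (by fun_prop)
    exact h1.inter h2
  have hI : I.card ≤ (n * (2 * N + 1)) ^ (2 * s) := by
    calc I.card ≤ (F ×ˢ F).card := Finset.card_filter_le _ _
      _ = F.card * F.card := Finset.card_product _ _
      _ ≤ (n * (2 * N + 1)) ^ s * (n * (2 * N + 1)) ^ s := Nat.mul_le_mul hcard hcard
      _ = _ := by rw [← pow_add, two_mul s]
  have hmeas : Measurable (WithLp.toLp 2 : (Fin n → ℝ) → EuclideanSpace ℝ (Fin n)) := by fun_prop
  have hsub : {A : Fin m → Fin n → ℝ | ¬ IsUniversalApproxRecovery Set.univ s ε (Matrix.of A)} ⊆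
      {A | ∃ q ∈ I, ∀ r, A r ∉ WithLp.toLp 2 ⁻¹' G q} := by
    intro A hA
    by_contra hA'
    simp only [Set.mem_ofPred_eq, not_exists, not_and, not_forall, not_not, Set.mem_preimage] at hA'
    apply hA
    apply isUniversalApproxRecovery_of_dist_le
    intro x y hx hy hxs hys hxy
    by_contra! hd
    obtain ⟨p, hp, hxp⟩ := hF x hx hxs
    obtain ⟨q, hq, hyq⟩ := hF y hy hys
    have hn : (1 : ℝ) ≤ n := by
      have : n ≠ 0 := by
        rintro rfl
        rw [Subsingleton.elim x 0, norm_zero] at hx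
        exact zero_ne_one hx
      exact_mod_cast Nat.one_le_iff_ne_zero.2 this
    -- Points more than ε apart thus have net points at least ε - 2 · ε/4 = ε/2 apart.
    have hδε : δ ≤ ε / 4 := by nlinarith
    have hpq : ε / 2 ≤ ‖p - q‖ := by
      have h1 : ‖x - y‖ ≤ ‖x - p‖ + ‖p - q‖ + ‖y - q‖ := by
        have : x - y = (x - p) + (p - q) - (y - q) := by abel
        rw [this]
        exact (norm_sub_le _ _).trans (by gcongr; exact norm_add_le _ _)
      linarith
    obtain ⟨r, hr1, hr2⟩ := hA' (p, q)
      (Finset.mem_filter.2 ⟨Finset.mem_product.2 ⟨hp, hq⟩, hpq⟩)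
    set a : EuclideanSpace ℝ (Fin n) := WithLp.toLp 2 (A r)
    have hclose (z w : EuclideanSpace ℝ (Fin n)) (hzw : ‖z - w‖ ≤ δ) :
        |⟪z, a⟫ - ⟪w, a⟫| ≤ δ * ‖a‖ := by
      rw [← inner_sub_left]
      exact (abs_real_inner_le_norm _ _).trans (by gcongr)
    have hxa : 0 < ⟪x, a⟫ := by
      have := (abs_le.1 (hclose x p hxp)).1
      simp only at hr1
      linarith
    have hya : ⟪y, a⟫ < 0 := by
      have := (abs_le.1 (hclose y q hyq)).2
      simp only at hr2
      linarith
    have := congrFun hxy r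
    rw [signMeasurement_eq_sign_inner, signMeasurement_eq_sign_inner] at this
    change SignType.sign ⟪x, a⟫ = SignType.sign ⟪y, a⟫ at this
    rw [sign_pos hxa, sign_neg hya] at this
    exact absurd this (by decide)
  calc _ ≤ _ := measure_mono hsub
    _ ≤ ENNReal.ofReal (I.card * Real.exp (-(ε / 6000 * m))) := by
      refine measure_pi_forall_notMem_le _ m I _ _ (fun q _ => hmeas (hG q)) fun q hq => ?_
      rw [← map_measureReal_apply hmeas (hG q), map_pi_eq_stdGaussian]
      obtain ⟨h1, h2⟩ := Finset.mem_filter.1 hq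
      obtain ⟨h3, h4⟩ := Finset.mem_product.1 h1
      exact le_stdGaussian_separates (hF1 _ h3) (hF1 _ h4) hε hε1 h2 hδ0 (by simpa using hδn)
    _ ≤ _ := by
      apply ENNReal.ofReal_le_ofReal
      gcongr
      exact_mod_cast hI

/-- In dimension one, a single Gaussian measurement is almost surely enough. -/
theorem gaussianMatrixLaw_one_not_recovery {s m : ℕ} (hm : 0 < m) {ε : ℝ} (hε : 0 < ε) :
    gaussianMatrixLaw m 1 {A | ¬ IsUniversalApproxRecovery Set.univ s ε (Matrix.of A)} = 0 := by
  have hsub : {A : Fin m → Fin 1 → ℝ | ¬ IsUniversalApproxRecovery Set.univ s ε (Matrix.of A)} ⊆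
      Set.univ.pi fun _ => Set.univ.pi fun _ => {0} := by
    intro A hA
    by_contra hA'
    simp only [Set.mem_pi, Set.mem_univ, forall_const, Set.mem_singleton_iff, not_forall] at hA'
    obtain ⟨r, j, hrj⟩ := hA'
    rw [Subsingleton.elim j 0] at hrj
    apply hA
    apply isUniversalApproxRecovery_of_dist_le
    intro x y hx hy _ _ hxy
    have hr := congrFun hxy r
    simp only [signMeasurement, Fin.sum_univ_one, sign_mul, Matrix.of_apply] at hr
    have hs : SignType.sign (x 0) = SignType.sign (y 0) :=
      mul_left_cancel₀ (sign_ne_zero.2 hrj) hr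
    have habs (z : EuclideanSpace ℝ (Fin 1)) (hz : ‖z‖ = 1) : |z 0| = 1 := by
      simpa [EuclideanSpace.norm_eq, Real.sqrt_sq_eq_abs] using hz
    have : x = y := by
      ext j
      rw [Subsingleton.elim j 0, ← sign_mul_abs (x 0), ← sign_mul_abs (y 0), habs x hx, habs y hy, hs]
    rw [this, sub_self, norm_zero]
    exact hε.le
  refine measure_mono_null hsub ?_
  have := nullSingletonClass_gaussianReal (μ := 0) (v := 1) one_ne_zero
  rw [gaussianMatrixLaw, Measure.pi_pi, Finset.prod_eq_zero (Finset.mem_univ ⟨0, hm⟩)]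
  rw [Measure.pi_pi, Finset.prod_eq_zero (Finset.mem_univ 0)]
  exact measure_singleton 0

/-- This is where the exponent 3/2 serves: since log k ≤ log n, twice the right-hand logarithm is at
least log n + 2 log(1/ε). -/
theorem log_div_le_two_mul_log {n k : ℕ} {ε : ℝ} (hk : 1 ≤ k) (hkn : k ≤ n) (hε : 0 < ε)
    (hε1 : ε ≤ 1) :
    Real.log (n / ε) ≤ 2 * Real.log ((n : ℝ) ^ (3 / 2 : ℝ) / (k * ε)) := by
  have hk' : (1 : ℝ) ≤ k := by exact_mod_cast hk
  have hkn' : (k : ℝ) ≤ n := by exact_mod_cast hkn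
  have hn : (0 : ℝ) < n := by linarith
  rw [Real.log_div hn.ne' hε.ne', Real.log_div (by positivity) (by positivity),
    Real.log_mul (by positivity) hε.ne', Real.log_rpow hn]
  have h1 := Real.log_le_log (by linarith) hkn'
  have h2 := Real.log_nonpos hε.le hε1
  linarith

theorem gaussianMatrixLaw_not_recovery_le_of_le {c : ℝ} (hc : 0 < c) {n k l m : ℕ} {ε η : ℝ}
    (hk : 1 ≤ k) (hkn : k ≤ n) (hl : (l : ℝ) ≤ c * k) (hε : 0 < ε) (hε1 : ε ≤ 1) (hη : 0 < η)
    (hη1 : η < 1)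
    (hm : 400000 * (1 + c) / ε *
      (k * Real.log ((n : ℝ) ^ (3 / 2 : ℝ) / (k * ε)) + Real.log (1 / η)) ≤ m) :
    gaussianMatrixLaw m n {A | ¬ IsUniversalApproxRecovery Set.univ (k + l) ε (Matrix.of A)}
      ≤ ENNReal.ofReal η := by
  have hk' : (1 : ℝ) ≤ k := by exact_mod_cast hk
  have hn1 : (1 : ℝ) ≤ n := by exact_mod_cast hk.trans hkn
  have hlog := log_div_le_two_mul_log hk hkn hε hε1
  have hη' : 0 < Real.log (1 / η) := Real.log_pos (by rw [lt_div_iff₀ hη]; linarith)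
  have hnε : (n : ℝ) ≤ n / ε := by
    rw [le_div_iff₀ hε]
    nlinarith
  have hlog0 : 0 ≤ Real.log (n / ε) := Real.log_nonneg (hn1.trans hnε)
  set L := Real.log ((n : ℝ) ^ (3 / 2 : ℝ) / (k * ε))
  set Λ := Real.log (n / ε) with hΛ
  have hL : 0 ≤ L := by linarith
  -- For n = 1 and ε = 1 the logarithm is 0 and cannot pay for the net, so dimension one is
  -- separate; log(1/η) > 0 still forces a row.
  rcases Nat.lt_or_ge n 2 with hn | hn
  · obtain rfl : n = 1 := by omega
    have hm0 : (0 : ℝ) < m := lt_of_lt_of_le (by positivity) hm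
    rw [gaussianMatrixLaw_one_not_recovery (by exact_mod_cast hm0) hε]
    exact zero_le
  have hn2 : (2 : ℝ) ≤ n := by exact_mod_cast hn
  set X : ℝ := n / ε with hX
  have hX2 : 2 ≤ X := hn2.trans hnε
  set N := ⌈1000 * X ^ 2⌉₊ with hNdef
  have hN1 : 1000 * X ^ 2 ≤ N := Nat.le_ceil _
  have hN2 : (N : ℝ) < 1000 * X ^ 2 + 1 := Nat.ceil_lt_add_one (by positivity)
  have hN0 : (0 : ℝ) < N := by nlinarith
  -- The factor 2048 = 2^11 is absorbed using X ≥ 2, so that only log X enters the exponent.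
  have hbase : ((n * (2 * N + 1) : ℕ) : ℝ) ≤ X ^ 14 := by
    push_cast
    have h1 : (2 * N + 1 : ℝ) ≤ 2048 * X ^ 2 := by nlinarith
    have h2 : (2 : ℝ) ^ 11 ≤ X ^ 11 := pow_le_pow_left₀ (by norm_num) hX2 11
    calc (n : ℝ) * (2 * N + 1) ≤ X * (2048 * X ^ 2) := by gcongr
      _ = 2 ^ 11 * X ^ 3 := by ring
      _ ≤ X ^ 11 * X ^ 3 := by gcongr
      _ = X ^ 14 := by ring
  refine (gaussianMatrixLaw_not_recovery_le (N := N) (by exact_mod_cast hN0) hε hε1 ?_).trans ?_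
  · have : (n : ℝ) = X * ε := by rw [hX]; field_simp
    rw [this]
    nlinarith [mul_le_mul_of_nonneg_left hN1 (sq_nonneg ε)]
  apply ENNReal.ofReal_le_ofReal
  have hX0 : 0 < X := by linarith
  -- 400000/6000 exceeds 66, while the net costs 28(k + l)Λ ≤ 56(1 + c)kL; the rest covers log(1/η).
  have hm' : 66 * (1 + c) * (k * L + Real.log (1 / η)) ≤ ε / 6000 * m := by
    rw [div_mul_eq_mul_div, div_le_iff₀ hε] at hm
    have : 0 ≤ (1 + c) * (k * L + Real.log (1 / η)) := by positivity
    linarith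
  have hs : ((k + l : ℕ) : ℝ) ≤ (1 + c) * k := by push_cast; linarith
  calc ((n * (2 * N + 1) : ℕ) : ℝ) ^ (2 * (k + l)) * Real.exp (-(ε / 6000 * m))
      ≤ (X ^ 14) ^ (2 * (k + l)) * Real.exp (-(ε / 6000 * m)) := by gcongr
    _ = Real.exp (28 * (k + l : ℕ) * Λ - ε / 6000 * m) := by
      rw [← pow_mul, ← Real.exp_log (pow_pos hX0 _), ← Real.exp_add, Real.log_pow, ← hΛ]
      congr 1
      push_cast
      ring
    _ ≤ Real.exp (Real.log η) := by
      apply Real.exp_le_exp.2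
      rw [one_div, Real.log_inv] at hm' hη'
      have h1 : ((k + l : ℕ) : ℝ) * Λ ≤ (1 + c) * k * (2 * L) := by gcongr
      have h2 : 0 ≤ (1 + c) * k * L := by positivity
      nlinarith
    _ = η := Real.exp_log hη

/-! ### Random Boolean matrices are list disjunct -/

/-- The Bernoulli law on `Bool` with probability `q` of `false`. -/
noncomputable def boolLaw (q : ℝ) : Measure Bool :=
  ENNReal.ofReal q • Measure.dirac false + ENNReal.ofReal (1 - q) • Measure.dirac true

theorem isProbabilityMeasure_boolLaw {q : ℝ} (hq0 : 0 ≤ q) (hq1 : q ≤ 1) :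
    IsProbabilityMeasure (boolLaw q) := by
  constructor
  simp only [boolLaw, Measure.coe_add, Measure.coe_smul, Pi.add_apply, Pi.smul_apply, measure_univ,
    smul_eq_mul, mul_one]
  rw [← ENNReal.ofReal_add hq0 (by linarith)]
  simp

theorem boolLaw_singleton_false (q : ℝ) : boolLaw q {false} = ENNReal.ofReal q := by
  simp [boolLaw]

theorem measureReal_pi_boolLaw_forall_false {n : ℕ} {q : ℝ} (hq0 : 0 ≤ q) (hq1 : q ≤ 1)
    (S : Finset (Fin n)) :
    (Measure.pi fun _ : Fin n => boolLaw q).real {a | ∀ j ∈ S, a j = false} = q ^ S.card := by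
  classical
  have := isProbabilityMeasure_boolLaw hq0 hq1
  have hset : {a : Fin n → Bool | ∀ j ∈ S, a j = false} =
      Set.univ.pi fun j => if j ∈ S then {false} else Set.univ := by
    ext a
    simp only [Set.mem_ofPred_eq, Set.mem_pi, Set.mem_univ, forall_const]
    refine forall_congr' fun j => ?_
    by_cases h : j ∈ S <;> simp [h]
  rw [hset, measureReal_def, Measure.pi_pi]
  have : ∀ j, boolLaw q (if j ∈ S then {false} else Set.univ) =
      if j ∈ S then ENNReal.ofReal q else 1 := by
    intro j
    split_ifs
    · exact boolLaw_singleton_false q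
    · exact measure_univ
  simp only [this, Finset.prod_ite_mem, Finset.univ_inter, Finset.prod_const]
  rw [ENNReal.toReal_pow, ENNReal.toReal_ofReal hq0]

/-- A random row with entries `1` of probability `1 / (2 k)` avoids a given set of `k` columns and
meets another one with probability at least `1 / 6`. -/
theorem le_measureReal_pi_boolLaw {n k : ℕ} (hk : 1 ≤ k) {S T : Finset (Fin n)}
    (hST : Disjoint S T) (hS : S.card = k) (hT : T.card = k) :
    1 / 6 ≤ (Measure.pi fun _ : Fin n => boolLaw (1 - 1 / (2 * k))).real
      {a | (∀ j ∈ S, a j = false) ∧ ∃ j ∈ T, a j = true} := by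
  classical
  have hk' : (1 : ℝ) ≤ k := by exact_mod_cast hk
  set q : ℝ := 1 - 1 / (2 * k) with hq
  have hk2 : 1 / (2 * (k : ℝ)) ≤ 1 / 2 := by
    apply one_div_le_one_div_of_le <;> linarith
  have hk0 : 0 < 1 / (2 * (k : ℝ)) := by positivity
  have hq0 : 0 ≤ q := by linarith
  have hq1 : q ≤ 1 := by linarith
  have := isProbabilityMeasure_boolLaw hq0 hq1
  -- Avoiding `S` but not `S ∪ T` has probability q^k(1 - q^k), and 1/2 ≤ q^k ≤ 2/3 gives 1/2 · 1/3.
  have hset : {a : Fin n → Bool | (∀ j ∈ S, a j = false) ∧ ∃ j ∈ T, a j = true} =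
      {a | ∀ j ∈ S, a j = false} \ {a | ∀ j ∈ S ∪ T, a j = false} := by
    ext a
    simp only [Set.mem_ofPred_eq, Set.mem_sdiff, Finset.mem_union]
    grind
  have hsub : {a : Fin n → Bool | ∀ j ∈ S ∪ T, a j = false} ⊆ {a | ∀ j ∈ S, a j = false} :=
    fun a ha j hj => ha j (Finset.mem_union_left _ hj)
  rw [hset, measureReal_sdiff hsub (Set.toFinite _).measurableSet,
    measureReal_pi_boolLaw_forall_false hq0 hq1, measureReal_pi_boolLaw_forall_false hq0 hq1,
    Finset.card_union_of_disjoint hST, hS, hT, pow_add]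
  have h1 : 1 / 2 ≤ q ^ k := by
    have := one_add_mul_le_pow (a := -(1 / (2 * (k : ℝ)))) (by linarith) k
    calc (1 / 2 : ℝ) = 1 + k * -(1 / (2 * (k : ℝ))) := by field_simp; norm_num
      _ ≤ (1 + -(1 / (2 * (k : ℝ)))) ^ k := this
      _ = q ^ k := by rw [hq, sub_eq_add_neg]
  have h2 : q ^ k ≤ 2 / 3 := by
    calc q ^ k ≤ Real.exp (-(1 / (2 * (k : ℝ)))) ^ k := by
          gcongr
          have := Real.add_one_le_exp (-(1 / (2 * (k : ℝ))))
          linarith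
      _ = Real.exp (-(1 / 2)) := by
          rw [← Real.exp_nat_mul]
          congr 1
          field_simp
      _ = (Real.exp (1 / 2))⁻¹ := Real.exp_neg _
      _ ≤ (1 / 2 + 1)⁻¹ := inv_anti₀ (by norm_num) (Real.add_one_le_exp _)
      _ = 2 / 3 := by norm_num
  nlinarith

theorem choose_le_exp_mul_log {n k : ℕ} (hk : 1 ≤ k) (hn : 1 ≤ n) :
    (n.choose k : ℝ) ≤ Real.exp (k * (1 + Real.log (n / k))) := by
  have hk' : (0 : ℝ) < k := by exact_mod_cast hk
  have hn' : (0 : ℝ) < n := by exact_mod_cast hn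
  calc (n.choose k : ℝ) ≤ (n : ℝ) ^ k / k.factorial := Nat.choose_le_pow_div k n
    _ = (n / k : ℝ) ^ k * ((k : ℝ) ^ k / k.factorial) := by
      rw [div_pow]; field_simp
    _ ≤ (n / k : ℝ) ^ k * Real.exp k := by
      gcongr
      exact Real.pow_div_factorial_le_exp _ hk'.le _
    _ = _ := by
      rw [mul_add, mul_one, Real.exp_add, Real.exp_nat_mul (Real.log _), Real.exp_log (by positivity)]
      ring

/-- At most (en/k)^{2k} pairs of column sets, each missed by all rows with probability at most
e^{-m/6}; hence 12 = 2 · 6. -/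
theorem exists_isListDisjunct_of_lt {n k m : ℕ} (hk : 1 ≤ k) (hn : 1 ≤ n)
    (hm : 12 * (k * (1 + Real.log (n / k))) < m) :
    ∃ M : Matrix (Fin m) (Fin n) ℝ, IsListDisjunct k k M := by
  classical
  have hk' : (1 : ℝ) ≤ k := by exact_mod_cast hk
  let q : ℝ := 1 - 1 / (2 * k)
  have hk2 : 1 / (2 * (k : ℝ)) ≤ 1 := by
    rw [div_le_one (by positivity)]; linarith
  have hk0 : 0 < 1 / (2 * (k : ℝ)) := by positivity
  have := isProbabilityMeasure_boolLaw (q := q) (by simp only [q]; linarith)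
    (by simp only [q]; linarith)
  let I : Finset (Finset (Fin n) × Finset (Fin n)) :=
    (Finset.univ.powersetCard k ×ˢ Finset.univ.powersetCard k).filter fun p => Disjoint p.1 p.2
  let G : Finset (Fin n) × Finset (Fin n) → Set (Fin n → Bool) :=
    fun p => {a | (∀ j ∈ p.1, a j = false) ∧ ∃ j ∈ p.2, a j = true}
  have hbad := measure_pi_forall_notMem_le (Measure.pi fun _ : Fin n => boolLaw q) m I G (1 / 6)
    (fun _ _ => (Set.toFinite _).measurableSet) (fun p hp => by
      obtain ⟨h1, h2⟩ := Finset.mem_filter.1 hp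
      obtain ⟨h3, h4⟩ := Finset.mem_product.1 h1
      exact le_measureReal_pi_boolLaw hk h2 (Finset.mem_powersetCard.1 h3).2
        (Finset.mem_powersetCard.1 h4).2)
  have hlt : (I.card : ℝ) * Real.exp (-(1 / 6 * m)) < 1 := by
    have hI : (I.card : ℝ) ≤ n.choose k * n.choose k := by
      have : I.card ≤ n.choose k * n.choose k := by
        refine (Finset.card_filter_le _ _).trans ?_
        rw [Finset.card_product, Finset.card_powersetCard, Finset.card_univ, Fintype.card_fin]
      exact_mod_cast this
    have hc := choose_le_exp_mul_log hk hn
    calc (I.card : ℝ) * Real.exp (-(1 / 6 * m))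
        ≤ (Real.exp (k * (1 + Real.log (n / k))) * Real.exp (k * (1 + Real.log (n / k)))) *
          Real.exp (-(1 / 6 * m)) := by
          gcongr
          exact hI.trans (by gcongr)
      _ = Real.exp (2 * (k * (1 + Real.log (n / k))) - 1 / 6 * m) := by
          rw [← Real.exp_add, ← Real.exp_add]; congr 1; ring
      _ < 1 := by
          rw [Real.exp_lt_one_iff]
          linarith
  obtain ⟨A, hA⟩ : ∃ A : Fin m → Fin n → Bool, ¬ ∃ p ∈ I, ∀ r, A r ∉ G p := by
    by_contra! h
    have huniv : {A : Fin m → Fin n → Bool | ∃ p ∈ I, ∀ r, A r ∉ G p} = Set.univ :=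
      Set.eq_univ_of_forall h
    rw [huniv, measure_univ, ENNReal.one_le_ofReal] at hbad
    linarith
  refine ⟨Matrix.of fun i j => if A i j then 1 else 0, fun i j => ?_, fun S T hST hS hT => ?_⟩
  · simp only [Matrix.of_apply]
    split_ifs <;> simp
  · push Not at hA
    obtain ⟨r, hr1, j, hj, hrj⟩ := hA (S, T) (by simp [I, hS, hT, hST])
    refine ⟨r, ⟨j, hj, by simp [hrj]⟩, fun j' hj' => ?_⟩
    simp [hr1 j' hj']

/-- List disjunct matrices with `l ≤ k` and `O(k log (n / k))` rows exist. -/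
theorem exists_isListDisjunct {n k : ℕ} (hk : 1 ≤ k) (hkn : k ≤ n) :
    ∃ (l m : ℕ) (M : Matrix (Fin m) (Fin n) ℝ), l ≤ k ∧
      (m : ℝ) ≤ 38 * (k * Real.log (n / k)) ∧ IsListDisjunct k l M := by
  have hk' : (1 : ℝ) ≤ k := by exact_mod_cast hk
  have hkn' : (k : ℝ) ≤ n := by exact_mod_cast hkn
  rcases Nat.lt_or_ge n (2 * k) with h | h
  · refine ⟨n - k + 1, 0, 0, by omega, ?_, fun i => i.elim0, fun S T hST hS hT => ?_⟩
    · have : 0 ≤ Real.log (n / k : ℝ) := Real.log_nonneg ((one_le_div (by linarith)).2 hkn')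
      push_cast
      positivity
    · have := Finset.card_le_univ (S.disjUnion T hST)
      rw [Finset.card_disjUnion, hS, hT, Fintype.card_fin] at this
      omega
  · have hlog : 1 / 2 ≤ Real.log (n / k : ℝ) := by
      have h1 : (2 : ℝ) ≤ n / k := by
        rw [le_div_iff₀ (by linarith)]; exact_mod_cast h
      have h2 := Real.log_le_log (by norm_num) h1
      have h3 := Real.log_two_gt_d9
      linarith
    obtain ⟨M, hM⟩ := exists_isListDisjunct_of_lt (n := n) (m := ⌊12 * (k * (1 + Real.log (n / k)))⌋₊ + 1)
      hk (hk.trans hkn) (by exact_mod_cast Nat.lt_floor_add_one _)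
    refine ⟨k, _, M, le_rfl, ?_, hM⟩
    have h4 := Nat.floor_le (a := 12 * (k * (1 + Real.log (n / k : ℝ)))) (by positivity)
    push_cast
    nlinarith

/-! ### Existence of both parts with the claimed sizes -/

/-- Failure probability 1/2 leaves a good matrix. As n ≥ 2, log 2 ≤ 2L, so the log 2 term and the
rounding up of the row count are absorbed into multiples of (k/ε)L. -/
theorem exists_isUniversalApproxRecovery {C : ℝ} (hC : 0 < C) {n k s : ℕ} {ε : ℝ} (hn : 2 ≤ n)
    (hk : 1 ≤ k) (hkn : k ≤ n) (hε : 0 < ε) (hε1 : ε ≤ 1)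
    (h : ∀ (m : ℕ), C / ε * (k * Real.log ((n : ℝ) ^ (3 / 2 : ℝ) / (k * ε)) +
        Real.log (1 / (1 / 2))) ≤ m →
      gaussianMatrixLaw m n {A | ¬ IsUniversalApproxRecovery Set.univ s ε (Matrix.of A)}
        ≤ ENNReal.ofReal (1 / 2)) :
    ∃ (m : ℕ) (M : Matrix (Fin m) (Fin n) ℝ),
      (m : ℝ) ≤ (3 * C + 4) * (k / ε * Real.log ((n : ℝ) ^ (3 / 2 : ℝ) / (k * ε))) ∧
      IsUniversalApproxRecovery Set.univ s ε M := by
  have hk' : (1 : ℝ) ≤ k := by exact_mod_cast hk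
  have hn' : (2 : ℝ) ≤ n := by exact_mod_cast hn
  have hlog := log_div_le_two_mul_log hk hkn hε hε1
  have hlog2 : Real.log 2 ≤ Real.log (n / ε) := by
    apply Real.log_le_log (by norm_num)
    rw [le_div_iff₀ hε]
    nlinarith
  have h2 := Real.log_two_gt_d9
  set L := Real.log ((n : ℝ) ^ (3 / 2 : ℝ) / (k * ε))
  have hL : 0 ≤ L := by linarith
  have hk1 : L ≤ k * L := by nlinarith
  set B := C / ε * (k * L + Real.log (1 / (1 / 2))) with hB
  have hB2 : B ≤ 3 * C * (k / ε * L) := by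
    have : C / ε * (k * L + Real.log (1 / (1 / 2))) ≤ C / ε * (3 * (k * L)) := by
      gcongr
      rw [one_div_one_div]
      linarith
    calc B ≤ C / ε * (3 * (k * L)) := this
      _ = _ := by ring
  have hkε : k * L ≤ k / ε * L := by
    gcongr
    rw [le_div_iff₀ hε]
    nlinarith
  have hB0 : 0 ≤ B := by
    rw [hB, one_div_one_div]
    positivity
  refine ⟨⌈B⌉₊, ?_⟩
  obtain ⟨A, hA⟩ : ∃ A : Fin ⌈B⌉₊ → Fin n → ℝ,
      IsUniversalApproxRecovery Set.univ s ε (Matrix.of A) := by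
    by_contra! h'
    have h1 := h ⌈B⌉₊ (Nat.le_ceil _)
    have huniv : {A : Fin ⌈B⌉₊ → Fin n → ℝ |
        ¬ IsUniversalApproxRecovery Set.univ s ε (Matrix.of A)} = Set.univ :=
      Set.eq_univ_of_forall h'
    rw [huniv, measure_univ, ENNReal.one_le_ofReal] at h1
    norm_num at h1
  refine ⟨Matrix.of A, ?_, hA⟩
  have := Nat.ceil_lt_add_one hB0
  linarith

theorem mainTheorem3 :
    -- any list disjunct matrix has no cancellation with any nonnegative signal
    (∀ (n k l m₁ : ℕ) (M₁ : Matrix (Fin m₁) (Fin n) ℝ) (x : EuclideanSpace ℝ (Fin n)),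
      IsListDisjunct k l M₁ → (∀ j, 0 ≤ x j) → NoCancellation M₁ x) ∧
    -- any two parts of the required kind yield universal recovery of nonnegative signals
    (∀ (n k l m₁ m₂ : ℕ) (ε : ℝ) (M₁ : Matrix (Fin m₁) (Fin n) ℝ)
      (M₂ : Matrix (Fin m₂) (Fin n) ℝ), 0 < ε →
      IsListDisjunct k l M₁ → IsApproxRecoveryWithin k (k + l) ε M₂ →
      IsUniversalApproxRecovery (Set.Ici 0) k ε (Matrix.fromRows M₁ M₂)) ∧
    -- a Gaussian second part is of the required kind with high probability
    (∀ c : ℝ, 0 < c → ∃ C : ℝ, 0 < C ∧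
      ∀ (n k l m₂ : ℕ) (ε η : ℝ), 1 ≤ k → k ≤ n → (l : ℝ) ≤ c * k → 0 < ε → ε ≤ 1 →
        0 < η → η < 1 →
        C / ε * (k * Real.log ((n : ℝ) ^ (3 / 2 : ℝ) / (k * ε)) + Real.log (1 / η)) ≤ m₂ →
        gaussianMatrixLaw m₂ n
          {A | ¬ IsUniversalApproxRecovery Set.univ (k + l) ε (Matrix.of A)}
            ≤ ENNReal.ofReal η) ∧
    -- two parts of the required kind and of the claimed sizes exist
    (∃ c C : ℝ, 0 < c ∧ 0 < C ∧
      ∀ (n k : ℕ) (ε : ℝ), 2 ≤ n → 1 ≤ k → k ≤ n → 0 < ε → ε ≤ 1 →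
        ∃ (l m₁ m₂ : ℕ) (M₁ : Matrix (Fin m₁) (Fin n) ℝ) (M₂ : Matrix (Fin m₂) (Fin n) ℝ),
          (l : ℝ) ≤ c * k ∧
          (m₁ : ℝ) ≤ C * (k * Real.log ((n : ℝ) / k)) ∧
          (m₂ : ℝ) ≤ C * (k / ε * Real.log ((n : ℝ) ^ (3 / 2 : ℝ) / (k * ε))) ∧
          IsListDisjunct k l M₁ ∧
          IsApproxRecoveryWithin k (k + l) ε M₂ ∧
          IsUniversalApproxRecovery (Set.Ici 0) k ε (Matrix.fromRows M₁ M₂)) := by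
  refine ⟨fun n k l m₁ M₁ x hM hx => hM.noCancellation hx,
    fun n k l m₁ m₂ ε M₁ M₂ _ h₁ h₂ => h₁.isUniversalApproxRecovery_fromRows h₂,
    fun c hc => ⟨400000 * (1 + c), by positivity, fun n k l m₂ ε η hk hkn hl hε hε1 hη hη1 hm =>
      gaussianMatrixLaw_not_recovery_le_of_le hc hk hkn hl hε hε1 hη hη1 hm⟩,
    1, 3 * (400000 * (1 + 1)) + 4, one_pos, by norm_num, fun n k ε hn hk hkn hε hε1 => ?_⟩
  obtain ⟨l, m₁, M₁, hl, hm₁, hM₁⟩ := exists_isListDisjunct hk hkn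
  have hl' : (l : ℝ) ≤ 1 * k := by
    rw [one_mul]
    exact_mod_cast hl
  obtain ⟨m₂, M₂, hm₂, hM₂⟩ := exists_isUniversalApproxRecovery (C := 400000 * (1 + 1)) (by norm_num)
    (s := k + l) hn hk hkn hε hε1 fun m hm =>
      gaussianMatrixLaw_not_recovery_le_of_le one_pos hk hkn hl' hε hε1 (by norm_num) (by norm_num) hm
  have hM₂' : IsApproxRecoveryWithin k (k + l) ε M₂ :=
    hM₂.isApproxRecoveryWithin (Nat.le_add_right k l)
  refine ⟨l, m₁, m₂, M₁, M₂, hl', hm₁.trans ?_, hm₂, hM₁, hM₂',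
    hM₁.isUniversalApproxRecovery_fromRows hM₂'⟩
  have : 0 ≤ Real.log ((n : ℝ) / k) := by
    apply Real.log_nonneg
    rw [one_le_div (by exact_mod_cast hk)]
    exact_mod_cast hkn
  gcongr
  norm_num
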